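/- Let $m\ge 1$, let $\mathbb T^N=\mathbb R^N/\mathbb Z^N$, and let $D=(d_{ij})_{1\le i,j\le m}$ be a constant real matrix with $d_{ii}\ge 0$, $d_{ij}\le 0$ for $i\ne j$, and $\sum_{j=1}^m d_{ij}=0$ for every $i$, which is irreducible: for every nonempty set $\mathcal I\subsetneq\{1,\dots,m\}$ there are $i\in\mathcal I$ and $j\notin\mathcal I$ with $d_{ij}\ne 0$. For $i=1,\dots,m$ let $H_i(x,p)=F_i(x,p)-f_i(x)$, where $F_i:\mathbb T^N\times\mathbb R^N\to\mathbb R$ and $f_i:\mathbb T^N\to\mathbb R$ are continuous, $F_i(x,\cdot)$ is convex and coercive ($F_i(x,p)\to+\infty$ as $|p|\to\infty$), $F_i(x,p)\ge F_i(x,0)=0$ and $f_i(x)\ge 0$ for all $x,p$. (The $f_i$ need not have a common zero.) Consider the ergodic problem, in the viscosity sense, $$H_i(x,Dv_i(x))+\sum_{j=1}^m d_{ij}v_j(x)=c_i,\qquad x\in\mathbb T^N,\ i=1,\dots,m, \tag{E}$$ with unknowns $c\in\mathbb R^m$ and $v=(v_1,\dots,v_m)\in C(\mathbb T^N)^m$.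 Then there is a number $c_1\in\mathbb R$ such that the vector $(c_1,\dots,c_1)\in\ker D$ and some Lipschitz continuous $v$ form a solution of (E), and $(c_1,\dots,c_1)$ is the only vector $c\in\ker D$ for which (E) has a solution $v\in C(\mathbb T^N)^m$. Moreover, there is a vector $\Lambda\in\mathbb R^m$ with $\Lambda_i>0$ for all $i$ and $D^T\Lambda=0$, and for every such $\Lambda$ $$\sum_{i=1}^m\Lambda_i\min_{x\in\mathbb T^N}f_i(x)\ \le\ -c_1\sum_{i=1}^m\Lambda_i\ \le\ \min_{x\in\mathbb T^N}\sum_{i=1}^m\Lambda_i f_i(x).$$ -/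

import Mathlib

open scoped Matrix

/-- The space `ℝ^N` with its Euclidean norm. -/
abbrev Space (N : ℕ) : Type := EuclideanSpace ℝ (Fin N)

/-- `g` is `1`-periodic in every coordinate, i.e. `g` is (the lift of) a function on the torus
`𝕋^N = ℝ^N / ℤ^N`. -/
def IsTorusPeriodic {N : ℕ} {α : Type*} (g : Space N → α) : Prop :=
  ∀ k : Fin N, Function.Periodic g (EuclideanSpace.single k (1 : ℝ))

/-- Sign conditions on a (constant) coupling matrix: nonnegative diagonal, nonpositive
off-diagonal entries, nonnegative row sums. -/
structure IsCouplingMatrix {m : ℕ} (D : Matrix (Fin m) (Fin m) ℝ) : Prop where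
  diag_nonneg : ∀ i, 0 ≤ D i i
  offDiag_nonpos : ∀ i j, i ≠ j → D i j ≤ 0
  rowSum_nonneg : ∀ i, 0 ≤ ∑ j, D i j

/-- Irreducibility: every nonempty proper set `I` of indices is linked to its complement, i.e.
`D i j ≠ 0` for some `i ∈ I`, `j ∉ I`. -/
def IsIrreducibleCoupling {m : ℕ} (D : Matrix (Fin m) (Fin m) ℝ) : Prop :=
  ∀ I : Set (Fin m), I.Nonempty → I ≠ Set.univ → ∃ i ∈ I, ∃ j ∉ I, D i j ≠ 0

/-- Structural hypotheses on the Hamiltonians `H_i(x,p) = F_i(x,p) - f_i(x)`: continuity,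
periodicity in `x`, convexity and coercivity of `F_i(x,·)`, `F_i(x,p) ≥ F_i(x,0) = 0`
and `f_i ≥ 0`. -/
structure IsEikonalSystem {m N : ℕ} (F : Fin m → Space N → Space N → ℝ)
    (f : Fin m → Space N → ℝ) : Prop where
  continuous_F : ∀ i, Continuous fun z : Space N × Space N => F i z.1 z.2
  continuous_f : ∀ i, Continuous (f i)
  periodic_F : ∀ i p, IsTorusPeriodic fun x => F i x p
  periodic_f : ∀ i, IsTorusPeriodic (f i)
  convex_F : ∀ i x, ConvexOn ℝ Set.univ (F i x)
  coercive_F : ∀ i x, Filter.Tendsto (F i x) (Filter.cocompact (Space N)) Filter.atTop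
  F_zero : ∀ i x, F i x 0 = 0
  F_nonneg : ∀ i x p, 0 ≤ F i x p
  f_nonneg : ∀ i x, 0 ≤ f i x

/-- `v` is a viscosity subsolution of
`H_i(x, Dv_i) + ∑_j d_ij v_j = c_i` in `ℝ^N`, `i = 1, …, m`. -/
def IsViscositySubsolution {m N : ℕ} (H : Fin m → Space N → Space N → ℝ)
    (D : Matrix (Fin m) (Fin m) ℝ) (c : Fin m → ℝ) (v : Fin m → Space N → ℝ) : Prop :=
  (∀ i, UpperSemicontinuous (v i)) ∧
  ∀ (φ : Space N → ℝ), ContDiff ℝ 1 φ → ∀ (i : Fin m) (x : Space N),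
    IsLocalMax (fun y => v i y - φ y) x →
      H i x (gradient φ x) + ∑ j, D i j * v j x ≤ c i

/-- `v` is a viscosity supersolution of
`H_i(x, Dv_i) + ∑_j d_ij v_j = c_i` in `ℝ^N`, `i = 1, …, m`. -/
def IsViscositySupersolution {m N : ℕ} (H : Fin m → Space N → Space N → ℝ)
    (D : Matrix (Fin m) (Fin m) ℝ) (c : Fin m → ℝ) (v : Fin m → Space N → ℝ) : Prop :=
  (∀ i, LowerSemicontinuous (v i)) ∧
  ∀ (φ : Space N → ℝ), ContDiff ℝ 1 φ → ∀ (i : Fin m) (x : Space N),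
    IsLocalMin (fun y => v i y - φ y) x →
      c i ≤ H i x (gradient φ x) + ∑ j, D i j * v j x

/-- `(c, v) ∈ ℝ^m × C(𝕋^N)^m` solves the ergodic problem
`H_i(x, Dv_i) + ∑_j d_ij v_j = c_i` on `𝕋^N`, `i = 1, …, m`, in the viscosity sense. -/
structure IsErgodicSolution {m N : ℕ} (H : Fin m → Space N → Space N → ℝ)
    (D : Matrix (Fin m) (Fin m) ℝ) (c : Fin m → ℝ) (v : Fin m → Space N → ℝ) : Prop where
  continuous : ∀ i, Continuous (v i)
  periodic : ∀ i, IsTorusPeriodic (v i)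
  subsolution : IsViscositySubsolution H D c v
  supersolution : IsViscositySupersolution H D c v

/-- `Λ` is a positive left null vector of `D`: `Λ_i > 0` for all `i` and `Dᵀ Λ = 0`. -/
def IsPositiveLeftNull {m : ℕ} (D : Matrix (Fin m) (Fin m) ℝ) (Λ : Fin m → ℝ) : Prop :=
  (∀ i, 0 < Λ i) ∧ Dᵀ *ᵥ Λ = 0

/-!
The solution is obtained from the discounted problems `ε v_i + H_i(x, Dv_i) + ∑_j d_ij v_j = 0`, that
is, from the coupling `D + ε • 1`, in the limit `ε → 0`.

* *A priori bounds.* As `F ≥ 0` and touching points are dense, a continuous subsolution satisfies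
  `ε v + D v ≤ f` pointwise. If moreover `v ≥ 0`, then `D v ≤ f`, and since `D v` is orthogonal to a
  positive vector `Λ` with `Dᵀ Λ = 0`, it is bounded on both sides independently of `ε`
  (`exists_abs_sum_mul_le_of_sum_mul_le`). So are `ε v` and, by coercivity, all test gradients, and
  `v` is Lipschitz with a constant independent of `ε` (`lipschitzWith_of_touching`).
* *Perron's method.* All nonnegative subsolutions being equi-Lipschitz, their supremum is Lipschitz,
  and it is a solution (`perronEnvelope_mem`, `perronEnvelope_supersolution`); no comparison
  principle and no semicontinuous envelopes are needed. The competitors are not assumed periodic,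
  which leaves room for local modifications; the supremum inherits the periodicity from the
  invariance of the equation under translations.
* *Limit.* The oscillation of `v` over the indices is bounded because `D v` is and `ker D` consists
  of constants (`exists_abs_sub_le_of_abs_mulVec_le`). After subtraction of one value the discounted
  solutions converge pointwise along an ultrafilter, `ε v` tends to a constant `-c₁`, and touching
  points are stable under such limits (`exists_touching_of_limit`).

Uniqueness of the constant is a doubling of variables in which the index is part of the
maximization (`le_of_subsolution_of_supersolution`). The bounds on `c₁` follow by weighting with `Λ`
the pointwise inequality `D v ≤ f + c₁` and the supersolution inequalities at the minimum points of
the components `v_i`.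
-/

open Filter Topology

/-! ### Irreducible coupling matrices -/

/-- A singular irreducible coupling matrix has a positive left null vector: the entrywise absolute
value of any nonzero vector in `ker Dᵀ` again lies in `ker Dᵀ`, and its support is everything by
irreducibility. -/
theorem exists_isPositiveLeftNull {m : ℕ} (hm : 0 < m) {D : Matrix (Fin m) (Fin m) ℝ}
    (hD : IsCouplingMatrix D) (hrow : ∀ i, ∑ j, D i j = 0) (hirr : IsIrreducibleCoupling D) :
    ∃ Λ : Fin m → ℝ, IsPositiveLeftNull D Λ := by
  have hdet : Dᵀ.det = 0 := by
    rw [Matrix.det_transpose]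
    refine Matrix.exists_mulVec_eq_zero_iff.1 ⟨fun _ => 1, ?_, ?_⟩
    · intro h
      simpa using congrFun h ⟨0, hm⟩
    · ext i
      simpa [Matrix.mulVec, dotProduct] using hrow i
  obtain ⟨w, hw0, hw⟩ := Matrix.exists_mulVec_eq_zero_iff.2 hdet
  have hw' : ∀ j, ∑ i, D i j * w i = 0 := fun j => by
    simpa [Matrix.mulVec, dotProduct] using congrFun hw j
  have hle : ∀ j, ∑ i, D i j * |w i| ≤ 0 := by
    intro j
    have h1 := hw' j
    rw [← Finset.add_sum_erase _ _ (Finset.mem_univ j)] at h1 ⊢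
    have h2 : D j j * |w j| = |∑ i ∈ Finset.univ.erase j, D i j * w i| := by
      rw [eq_neg_of_add_eq_zero_right h1, abs_neg, abs_mul, abs_of_nonneg (hD.diag_nonneg j)]
    have h3 : |∑ i ∈ Finset.univ.erase j, D i j * w i|
        ≤ ∑ i ∈ Finset.univ.erase j, -(D i j * |w i|) := by
      refine (Finset.abs_sum_le_sum_abs _ _).trans (Finset.sum_le_sum fun i hi => ?_)
      rw [abs_mul, abs_of_nonpos (hD.offDiag_nonpos i j (Finset.ne_of_mem_erase hi))]
      linarith
    rw [Finset.sum_neg_distrib] at h3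
    linarith
  have hsum : ∑ j, ∑ i, D i j * |w i| = 0 := by
    rw [Finset.sum_comm]
    simp [← Finset.sum_mul, hrow]
  have heq : ∀ j, ∑ i, D i j * |w i| = 0 := fun j =>
    (Finset.sum_eq_zero_iff_of_nonpos (fun j _ => hle j)).1 hsum j (Finset.mem_univ j)
  refine ⟨fun i => |w i|, fun i => ?_, ?_⟩
  · by_contra hi
    have hi0 : w i = 0 := by simpa using hi
    obtain ⟨k, hk⟩ := Function.ne_iff.1 hw0
    obtain ⟨a, ha, b, hb, hab⟩ := hirr {i | w i ≠ 0} ⟨k, hk⟩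
      (fun h => by simpa [hi0] using h.ge (Set.mem_univ i))
    have hb0 : w b = 0 := by simpa using hb
    have hne : a ≠ b := fun h => ha (h ▸ hb0)
    have hterm : ∀ i ∈ Finset.univ, D i b * |w i| ≤ 0 := by
      intro i _
      by_cases h : i = b
      · simp [h, hb0]
      · exact mul_nonpos_of_nonpos_of_nonneg (hD.offDiag_nonpos i b h) (abs_nonneg _)
    have := (Finset.sum_eq_zero_iff_of_nonpos hterm).1 (heq b) a (Finset.mem_univ a)
    simp only [mul_eq_zero, abs_eq_zero] at this
    exact this.elim hab ha
  · ext j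
    simpa [Matrix.mulVec, dotProduct] using heq j

/-- Weighting the equations by a left null vector removes the coupling. -/
theorem sum_mul_sum_eq_zero {m : ℕ} {D : Matrix (Fin m) (Fin m) ℝ} {Λ : Fin m → ℝ}
    (hΛ : IsPositiveLeftNull D Λ) (u : Fin m → ℝ) :
    ∑ i, Λ i * ∑ j, D i j * u j = 0 := by
  simp_rw [Finset.mul_sum]
  rw [Finset.sum_comm]
  refine Finset.sum_eq_zero fun j _ => ?_
  have h1 : ∑ i, D i j * Λ i = 0 := by
    simpa [Matrix.mulVec, dotProduct] using congrFun hΛ.2 j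
  calc ∑ i, Λ i * (D i j * u j) = (∑ i, D i j * Λ i) * u j := by
        rw [Finset.sum_mul]; exact Finset.sum_congr rfl fun i _ => by ring
    _ = 0 := by rw [h1, zero_mul]

/-- An upper bound on `D u` implies a two-sided bound, because `D u` is orthogonal to a positive
vector. -/
theorem exists_abs_sum_mul_le_of_sum_mul_le {m : ℕ} {D : Matrix (Fin m) (Fin m) ℝ}
    {Λ : Fin m → ℝ} (hΛ : IsPositiveLeftNull D Λ) {B : ℝ} (hB : 0 ≤ B) :
    ∃ C, 0 ≤ C ∧ ∀ u : Fin m → ℝ, (∀ i, ∑ j, D i j * u j ≤ B) → ∀ i, |∑ j, D i j * u j| ≤ C := by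
  obtain ⟨L, hL⟩ := (Set.finite_range fun i => B * (∑ k, Λ k) / Λ i).bddAbove
  refine ⟨max L B, hB.trans (le_max_right _ _), fun u hu i => abs_le.2
    ⟨?_, (hu i).trans (le_max_right _ _)⟩⟩
  have h1 : ∑ k, Λ k * (B - ∑ j, D k j * u j) = B * ∑ k, Λ k := by
    simp_rw [mul_sub, Finset.sum_sub_distrib, sum_mul_sum_eq_zero hΛ, ← Finset.sum_mul]
    ring
  have h2 : Λ i * (B - ∑ j, D i j * u j) ≤ B * ∑ k, Λ k := by
    rw [← h1]
    exact Finset.single_le_sum (f := fun k => Λ k * (B - ∑ j, D k j * u j))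
      (fun k _ => mul_nonneg (hΛ.1 k).le (sub_nonneg.2 (hu k))) (Finset.mem_univ i)
  have h3 : B - ∑ j, D i j * u j ≤ L :=
    ((le_div_iff₀' (hΛ.1 i)).2 h2).trans (hL ⟨i, rfl⟩)
  linarith [le_max_left L B]

/-- A maximum principle: vectors in the kernel of an irreducible singular coupling matrix are
constant. -/
theorem eq_of_mulVec_eq_zero {m : ℕ} {D : Matrix (Fin m) (Fin m) ℝ}
    (hD : IsCouplingMatrix D) (hrow : ∀ i, ∑ j, D i j = 0) (hirr : IsIrreducibleCoupling D)
    {c : Fin m → ℝ} (hc : D *ᵥ c = 0) (i j : Fin m) : c i = c j := by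
  have : Nonempty (Fin m) := ⟨i⟩
  obtain ⟨k, hk⟩ := Finite.exists_max c
  have huniv : {i | c i = c k} = Set.univ := by
    by_contra hne
    obtain ⟨a, ha, b, hb, hab⟩ := hirr {i | c i = c k} ⟨k, rfl⟩ hne
    have ha' : c a = c k := ha
    have hlt : c b < c k := lt_of_le_of_ne (hk b) hb
    have hab' : a ≠ b := fun h => hb (h ▸ ha)
    have h0 : ∑ j, D a j * (c j - c k) = 0 := by
      have : ∑ j, D a j * c j = 0 := by
        simpa [Matrix.mulVec, dotProduct] using congrFun hc a
      simp [mul_sub, Finset.sum_sub_distrib, this, ← Finset.sum_mul, hrow]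
    have hterm : ∀ j ∈ Finset.univ, 0 ≤ D a j * (c j - c k) := by
      intro j _
      by_cases h : a = j
      · subst h; simp [ha']
      · exact mul_nonneg_of_nonpos_of_nonpos (hD.offDiag_nonpos a j h) (by linarith [hk j])
    have := (Finset.sum_eq_zero_iff_of_nonneg hterm).1 h0 b (Finset.mem_univ b)
    exact (mul_ne_zero hab (sub_ne_zero.2 hlt.ne)) this
  have h1 : c i = c k := huniv.ge (Set.mem_univ i)
  have h2 : c j = c k := huniv.ge (Set.mem_univ j)
  rw [h1, h2]

/-- The oscillation of a vector is controlled by its image under an irreducible singular coupling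
matrix. -/
theorem exists_abs_sub_le_of_abs_mulVec_le {m : ℕ} {D : Matrix (Fin m) (Fin m) ℝ}
    (hD : IsCouplingMatrix D) (hrow : ∀ i, ∑ j, D i j = 0) (hirr : IsIrreducibleCoupling D)
    (k : Fin m) {B : ℝ} (hB : 0 ≤ B) :
    ∃ C, ∀ u : Fin m → ℝ, (∀ i, |∑ j, D i j * u j| ≤ B) → ∀ i, |u i - u k| ≤ C := by
  let T : (Fin m → ℝ) →ₗ[ℝ] (Fin m → ℝ) × ℝ := D.mulVecLin.prod (LinearMap.proj k)
  have hT : LinearMap.ker T = ⊥ := by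
    refine (LinearMap.ker_eq_bot').2 fun u hu => ?_
    have h1 : D *ᵥ u = 0 := congrArg Prod.fst hu
    have h2 : u k = 0 := congrArg Prod.snd hu
    ext i
    rw [eq_of_mulVec_eq_zero hD hrow hirr h1 i k, h2]
    rfl
  obtain ⟨K, -, hK⟩ := T.exists_antilipschitzWith hT
  refine ⟨K * B, fun u hu i => ?_⟩
  have h1 : ‖u - fun _ => u k‖ ≤ K * ‖T (u - fun _ => u k)‖ := by
    simpa only [dist_zero_right, map_zero] using hK.le_mul_dist (u - fun _ => u k) 0
  have h2 : ‖T (u - fun _ => u k)‖ ≤ B := by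
    refine (Prod.norm_def _).trans_le (max_le ?_ ?_)
    · refine (pi_norm_le_iff_of_nonneg hB).2 fun i => ?_
      have : (T (u - fun _ => u k)).1 i = ∑ j, D i j * u j := by
        simp [T, Matrix.mulVec, dotProduct, mul_sub, Finset.sum_sub_distrib, ← Finset.sum_mul, hrow]
      rw [this]
      exact hu i
    · simpa [T] using hB
  calc |u i - u k| = ‖(u - fun _ => u k : Fin m → ℝ) i‖ := rfl
    _ ≤ ‖u - fun _ => u k‖ := norm_le_pi_norm _ i
    _ ≤ _ := h1.trans (by gcongr)

/-! ### Periodic functions -/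

/-- A compact set representing every point of the torus. -/
theorem exists_isCompact_forall_torusPeriodic (N : ℕ) :
    ∃ Q : Set (Space N), IsCompact Q ∧
      ∀ x, ∃ y ∈ Q, ∀ g : Space N → ℝ, IsTorusPeriodic g → g x = g y := by
  refine ⟨WithLp.toLp 2 '' (Set.univ.pi fun _ => Set.Icc (0 : ℝ) 1),
    (isCompact_univ_pi fun _ => isCompact_Icc).image (PiLp.continuous_toLp 2 _), fun x => ?_⟩
  refine ⟨WithLp.toLp 2 fun k => Int.fract (x k),
    ⟨_, fun k _ => ⟨Int.fract_nonneg _, (Int.fract_lt_one _).le⟩, rfl⟩, fun g hg => ?_⟩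
  have key : ∀ s : Finset (Fin N), ∀ z,
      g (z + ∑ k ∈ s, ⌊x k⌋ • EuclideanSpace.single k (1 : ℝ)) = g z := by
    intro s
    induction s using Finset.induction_on with
    | empty => simp
    | insert a s ha ih =>
      intro z
      rw [Finset.sum_insert ha, ← add_assoc, ih]
      exact (hg a).zsmul _ z
  rw [← key Finset.univ (WithLp.toLp 2 fun k => Int.fract (x k))]
  congr 1
  ext k
  simp [Pi.single_apply, Int.fract_add_floor]

theorem IsTorusPeriodic.exists_isLeast {N : ℕ} {g : Space N → ℝ} (hg : IsTorusPeriodic g)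
    (hc : Continuous g) : ∃ x, IsLeast (Set.range g) (g x) := by
  obtain ⟨Q, hQ, hQp⟩ := exists_isCompact_forall_torusPeriodic N
  obtain ⟨q, hq, -⟩ := hQp 0
  obtain ⟨x, -, hx⟩ := hQ.exists_isMinOn ⟨q, hq⟩ hc.continuousOn
  refine ⟨x, ⟨x, rfl⟩, ?_⟩
  rintro _ ⟨y, rfl⟩
  obtain ⟨z, hz, h⟩ := hQp y
  rw [h g hg]
  exact hx hz

theorem IsTorusPeriodic.exists_abs_le {N : ℕ} {g : Space N → ℝ} (hg : IsTorusPeriodic g)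
    (hc : Continuous g) : ∃ C, ∀ x, |g x| ≤ C := by
  obtain ⟨Q, hQ, hQp⟩ := exists_isCompact_forall_torusPeriodic N
  obtain ⟨C, hC⟩ := hQ.exists_bound_of_continuousOn hc.continuousOn
  refine ⟨C, fun y => ?_⟩
  obtain ⟨z, hz, h⟩ := hQp y
  rw [h g hg]
  exact hC z hz

/-- A common bound for finitely many periodic functions. -/
theorem exists_forall_abs_le {ι : Type*} [Finite ι] {N : ℕ} {g : ι → Space N → ℝ}
    (hg : ∀ i, IsTorusPeriodic (g i)) (hc : ∀ i, Continuous (g i)) :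
    ∃ C, 0 ≤ C ∧ ∀ i x, |g i x| ≤ C := by
  choose C hC using fun i => (hg i).exists_abs_le (hc i)
  obtain ⟨M, hM⟩ := (Set.finite_range C).bddAbove
  exact ⟨max M 0, le_max_right _ _, fun i x =>
    (hC i x).trans ((hM ⟨i, rfl⟩).trans (le_max_left _ _))⟩

/-! ### Gradients of test functions -/

section gradient
variable {N : ℕ} {φ ψ : Space N → ℝ}

theorem ContDiff.continuous_gradient (hφ : ContDiff ℝ 1 φ) : Continuous (gradient φ) :=
  (InnerProductSpace.toDual ℝ (Space N)).symm.continuous.comp (hφ.continuous_fderiv (by simp))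

theorem gradient_add_of_contDiff (hφ : ContDiff ℝ 1 φ) (hψ : ContDiff ℝ 1 ψ) (x : Space N) :
    gradient (fun y => φ y + ψ y) x = gradient φ x + gradient ψ x := by
  unfold gradient
  rw [fderiv_fun_add (hφ.differentiable (by simp) x) (hψ.differentiable (by simp) x), map_add]

theorem gradient_fun_neg (x : Space N) : gradient (fun y => -φ y) x = -gradient φ x := by
  unfold gradient
  rw [fderiv_fun_neg, map_neg]

theorem gradient_comp_add (a x : Space N) :
    gradient (fun y => φ (y + a)) x = gradient φ (x + a) := by
  unfold gradient
  rw [fderiv_comp_add_right]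

theorem contDiff_mul_norm_sub_sq (a : ℝ) (x₀ : Space N) :
    ContDiff ℝ 1 fun y : Space N => a * ‖y - x₀‖ ^ 2 :=
  contDiff_const.mul ((contDiff_id.sub contDiff_const).norm_sq ℝ)

theorem gradient_mul_norm_sub_sq (a : ℝ) (x₀ x : Space N) :
    gradient (fun y : Space N => a * ‖y - x₀‖ ^ 2) x = (2 * a) • (x - x₀) := by
  refine HasGradientAt.gradient ?_
  rw [hasGradientAt_iff_hasFDerivAt]
  convert! (((hasFDerivAt_id x).sub_const x₀).norm_sq).const_mul a using 1
  ext v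
  simp
  ring

theorem gradient_eq_of_isLocalMax_sub (hφ : ContDiff ℝ 1 φ) (hψ : ContDiff ℝ 1 ψ) {x : Space N}
    (h : IsLocalMax (fun y => φ y - ψ y) x) : gradient φ x = gradient ψ x := by
  have h1 := h.fderiv_eq_zero
  rw [fderiv_fun_sub (hφ.differentiable (by simp) x) (hψ.differentiable (by simp) x),
    sub_eq_zero] at h1
  unfold gradient
  rw [h1]

end gradient

/-! ### Touching by test functions -/

section touching
variable {N : ℕ} {u : Space N → ℝ}

/-- A continuous function is touched from above by `C¹` functions at a dense set of points, so a
continuous inequality that holds at all touching points holds everywhere. -/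
theorem forall_nonpos_of_touching {G : Space N → ℝ} (hu : Continuous u) (hG : Continuous G)
    (h : ∀ φ : Space N → ℝ, ContDiff ℝ 1 φ → ∀ x, IsLocalMax (fun y => u y - φ y) x → G x ≤ 0)
    (x : Space N) : G x ≤ 0 := by
  by_contra! hx
  obtain ⟨r, hr, hball⟩ := Metric.nhds_basis_closedBall.eventually_iff.1
    ((hG.tendsto x).eventually_const_lt hx)
  obtain ⟨M, hM⟩ := (isCompact_closedBall x r).exists_bound_of_continuousOn hu.continuousOn
  -- The coefficient makes the penalty exceed the oscillation of `u` on the boundary sphere.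
  set a : ℝ := (2 * M + 1) / r ^ 2
  have hφ := contDiff_mul_norm_sub_sq a x
  obtain ⟨y, hy, hmax⟩ := (isCompact_closedBall x r).exists_isMaxOn
    ⟨x, Metric.mem_closedBall_self hr.le⟩ (hu.sub hφ.continuous).continuousOn
  have hyx : u x - a * ‖x - x‖ ^ 2 ≤ u y - a * ‖y - x‖ ^ 2 :=
    hmax (Metric.mem_closedBall_self hr.le)
  have hlt : dist y x < r := by
    refine lt_of_le_of_ne hy fun heq => ?_
    have h1 := abs_le.1 (hM y hy)
    have h2 := abs_le.1 (hM x (Metric.mem_closedBall_self hr.le))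
    rw [dist_eq_norm] at heq
    have h3 : a * r ^ 2 = 2 * M + 1 := by simp only [a]; field_simp
    rw [heq, h3, sub_self, norm_zero] at hyx
    norm_num at hyx
    linarith [h1.2, h2.1]
  have := h _ hφ y (hmax.isLocalMax (Metric.closedBall_mem_nhds_of_mem hlt))
  exact absurd (hball hy) this.not_gt

/-- A bounded continuous function all of whose upper test gradients have norm at most `R` is
`R`-Lipschitz. The function is compared with the smooth cones `(R + τ) √(η² + |y - x|²)`: the
gradient bound forces the contact point to be close to the vertex `x`. -/
theorem lipschitzWith_of_touching {M : ℝ} {R : NNReal} (hu : Continuous u) (hM : ∀ x, |u x| ≤ M)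
    (h : ∀ φ : Space N → ℝ, ContDiff ℝ 1 φ → ∀ x, IsLocalMax (fun y => u y - φ y) x →
      ‖gradient φ x‖ ≤ R) : LipschitzWith R u := by
  have key : ∀ z x, ∀ t > 0, u z ≤ u x + t + (R + t) * (‖z - x‖ + t) := by
    intro z x t ht
    obtain ⟨δ, hδ, hball⟩ := Metric.nhds_basis_ball.eventually_iff.1
      ((hu.tendsto x).eventually_lt_const (lt_add_of_pos_right (u x) ht))
    have hR : (0 : ℝ) ≤ R := R.2
    obtain ⟨η, hη, hηt, hηδ⟩ : ∃ η : ℝ, 0 < η ∧ η ≤ t ∧ (R + 1) * η ≤ δ * t := by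
      refine ⟨min t (δ * t / (R + 1)), by positivity, min_le_left _ _, ?_⟩
      rw [← le_div_iff₀' (by positivity)]
      exact min_le_right _ _
    set S : Space N → ℝ := fun y => √(η ^ 2 + ‖y - x‖ ^ 2)
    have hpos : ∀ y, 0 < η ^ 2 + ‖y - x‖ ^ 2 := fun y => by positivity
    have hSC : ContDiff ℝ 1 S :=
      (contDiff_const.add ((contDiff_id.sub contDiff_const).norm_sq ℝ)).sqrt fun y => (hpos y).ne'
    have hφ : ContDiff ℝ 1 fun y => (R + t) * S y := contDiff_const.mul hSC
    have hgrad : ∀ y, gradient (fun y => (R + t) * S y) y = ((R + t) / S y) • (y - x) := by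
      intro y
      refine HasGradientAt.gradient ?_
      rw [hasGradientAt_iff_hasFDerivAt]
      convert! (((((hasFDerivAt_id y).sub_const x).norm_sq).const_add (η ^ 2)).sqrt
        (hpos y).ne').const_mul (R + t : ℝ) using 1
      ext v
      simp [S]
      ring
    have hSle : ∀ y, ‖y - x‖ ≤ S y := fun y => Real.le_sqrt_of_sq_le (by nlinarith)
    have hlim : Tendsto (fun y => u y - (R + t) * S y) (cocompact (Space N)) atBot := by
      have h1 : Tendsto (fun y : Space N => M - t * (‖y‖ - ‖x‖)) (cocompact _) atBot := by
        refine tendsto_const_nhds.add_atBot (tendsto_neg_atTop_atBot.comp ?_)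
        exact (tendsto_atTop_add_const_right _ (-‖x‖)
          (tendsto_norm_cocompact_atTop (E := Space N))).const_mul_atTop ht
      refine tendsto_atBot_mono (fun y => ?_) h1
      have h2 := (abs_le.1 (hM y)).2
      have h3 := norm_sub_norm_le y x
      have h4 : t * (‖y‖ - ‖x‖) ≤ t * S y := by gcongr; exact h3.trans (hSle y)
      have h5 : 0 ≤ R * S y := mul_nonneg hR (Real.sqrt_nonneg _)
      linarith
    obtain ⟨y, hy⟩ := (hu.sub hφ.continuous).exists_forall_ge hlim
    have hg := h _ hφ y (Eventually.of_forall hy)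
    have hSpos : 0 < S y := Real.sqrt_pos.2 (hpos y)
    rw [hgrad, norm_smul, Real.norm_of_nonneg (by positivity), div_mul_eq_mul_div,
      div_le_iff₀ hSpos] at hg
    have hclose : ‖y - x‖ < δ := by
      have h1 : ((R + t) * ‖y - x‖) ^ 2 ≤ R ^ 2 * (η ^ 2 + ‖y - x‖ ^ 2) := by
        rw [← Real.sq_sqrt (hpos y).le, ← mul_pow]
        gcongr
      have h2 : t * ‖y - x‖ ≤ R * η := by
        refine abs_le_of_sq_le_sq' ?_ (by positivity) |>.2
        nlinarith [mul_nonneg (mul_nonneg hR ht.le) (sq_nonneg ‖y - x‖)]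
      by_contra! h3
      nlinarith
    have h1 : u y < u x + t := hball (by simpa [dist_eq_norm] using hclose)
    have h2 := hy z
    have h3 : S z ≤ ‖z - x‖ + t := by
      refine Real.sqrt_le_iff.2 ⟨by positivity, ?_⟩
      nlinarith [norm_nonneg (z - x)]
    have h4 : (R + t) * S z ≤ (R + t) * (‖z - x‖ + t) := by gcongr
    have h5 : 0 ≤ (R + t) * S y := by positivity
    simp only [Pi.sub_apply] at h2
    linarith
  refine LipschitzWith.of_le_add_mul R fun z x => ?_
  have hlim : Tendsto (fun t : ℝ => u x + t + (R + t) * (‖z - x‖ + t)) (𝓝[>] 0)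
      (𝓝 (u x + 0 + (R + 0) * (‖z - x‖ + 0))) :=
    (Continuous.tendsto (by fun_prop) 0).mono_left nhdsWithin_le_nhds
  have := ge_of_tendsto hlim (eventually_nhdsWithin_of_forall fun t ht => key z x t ht)
  simpa [dist_eq_norm] using this

theorem tendsto_apply_of_lipschitzWith {K : NNReal} {v : ℕ → Space N → ℝ}
    (hv : ∀ n, LipschitzWith K (v n)) {l : Filter ℕ} {x : Space N} {t : ℝ}
    (hx : Tendsto (fun n => v n x) l (𝓝 t)) {y : ℕ → Space N} (hy : Tendsto y l (𝓝 x)) :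
    Tendsto (fun n => v n (y n)) l (𝓝 t) := by
  have h0 : Tendsto (fun n => K * dist (y n) x) l (𝓝 0) := by
    simpa using (hy.dist (tendsto_const_nhds (x := x))).const_mul (K : ℝ)
  have h1 : Tendsto (fun n => v n (y n) - v n x) l (𝓝 0) :=
    squeeze_zero_norm (fun n => (hv n).dist_le_mul (y n) x) h0
  simpa using h1.add hx

/-- Stability of touching points: if equi-Lipschitz functions `v n` are asymptotically below `u`
along an ultrafilter and converge to `u` at a point where `φ` touches `u` from above, then a
perturbation `ψ` of `φ` with the same gradient there touches, up to a constant, almost all `v n` at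
points converging to the given one. -/
theorem exists_touching_of_limit {K : NNReal} {v : ℕ → Space N → ℝ}
    (hv : ∀ n, LipschitzWith K (v n)) {l : Ultrafilter ℕ} {x : Space N}
    (hle : ∀ z, ∀ ε > 0, ∀ᶠ n in l, v n z ≤ u z + ε)
    (hx : Tendsto (fun n => v n x) l (𝓝 (u x))) {φ : Space N → ℝ} (hφ : ContDiff ℝ 1 φ)
    (hmax : IsLocalMax (fun y => u y - φ y) x) :
    ∃ (ψ : Space N → ℝ) (y : ℕ → Space N), ContDiff ℝ 1 ψ ∧ gradient ψ x = gradient φ x ∧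
      Tendsto y l (𝓝 x) ∧ Tendsto (fun n => v n (y n)) l (𝓝 (u x)) ∧
      ∀ᶠ n in l, IsLocalMax (fun z => v n z - ψ z) (y n) := by
  have hq := contDiff_mul_norm_sub_sq 1 x
  set ψ : Space N → ℝ := fun y => φ y + 1 * ‖y - x‖ ^ 2 with hψdef
  have hψ : ContDiff ℝ 1 ψ := hφ.add hq
  have hψx : gradient ψ x = gradient φ x := by
    rw [hψdef, gradient_add_of_contDiff hφ hq, gradient_mul_norm_sub_sq]
    simp
  obtain ⟨r, hr, hball⟩ := Metric.nhds_basis_closedBall.eventually_iff.1 hmax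
  have hxr : x ∈ Metric.closedBall x r := Metric.mem_closedBall_self hr.le
  choose y hyr hy using fun n => (isCompact_closedBall x r).exists_isMaxOn ⟨x, hxr⟩
    ((hv n).continuous.sub hψ.continuous).continuousOn
  obtain ⟨z, hzr, hz⟩ := (isCompact_closedBall x r).ultrafilter_le_nhds' (l.map y)
    (Ultrafilter.mem_map.2 (Eventually.of_forall hyr))
  have hyz : Tendsto y l (𝓝 z) := hz
  have hzx : ‖z - x‖ ^ 2 ≤ 0 := by
    refine le_of_forall_pos_le_add fun ε hε => ?_
    have hlim : Tendsto (fun n => v n x - ψ x + ψ (y n) - K * ‖y n - z‖) l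
        (𝓝 (u x - ψ x + ψ z - K * ‖z - z‖)) :=
      ((hx.sub_const _).add ((hψ.continuous.tendsto z).comp hyz)).sub
        (((hyz.sub_const z).norm).const_mul _)
    have h1 : u x - ψ x + ψ z - K * ‖z - z‖ ≤ u z + ε := by
      refine le_of_tendsto hlim ?_
      filter_upwards [hle z ε hε] with n hn
      have h2 : v n x - ψ x ≤ v n (y n) - ψ (y n) := hy n hxr
      have h3 := (hv n).le_add_mul (y n) z
      rw [dist_eq_norm] at h3
      linarith
    have h4 : u z - φ z ≤ u x - φ x := hball hzr
    simp only [hψdef, sub_self, norm_zero] at h1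
    norm_num at h1
    linarith
  have hzx' : z = x := by
    have : ‖z - x‖ = 0 := by nlinarith [norm_nonneg (z - x)]
    simpa [sub_eq_zero] using this
  rw [hzx'] at hyz
  refine ⟨ψ, y, hψ, hψx, hyz, tendsto_apply_of_lipschitzWith hv hx hyz, ?_⟩
  filter_upwards [hyz (Metric.ball_mem_nhds x hr)] with n hn
  exact (hy n).isLocalMax (Metric.closedBall_mem_nhds_of_mem hn)

/-- The counterpart of `exists_touching_of_limit` for touching from below. -/
theorem exists_touching_below_of_limit {K : NNReal} {v : ℕ → Space N → ℝ}
    (hv : ∀ n, LipschitzWith K (v n)) {l : Ultrafilter ℕ}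
    (hlim : ∀ z, Tendsto (fun n => v n z) l (𝓝 (u z))) {φ : Space N → ℝ} (hφ : ContDiff ℝ 1 φ)
    {x : Space N} (hmin : IsLocalMin (fun y => u y - φ y) x) :
    ∃ (ψ : Space N → ℝ) (y : ℕ → Space N), ContDiff ℝ 1 ψ ∧ gradient ψ x = gradient φ x ∧
      Tendsto y l (𝓝 x) ∧ ∀ᶠ n in l, IsLocalMin (fun z => v n z - ψ z) (y n) := by
  obtain ⟨ψ, y, hψ, hgrad, hy, -, hloc⟩ := exists_touching_of_limit (u := fun z => -u z)
    (v := fun n z => -v n z) (φ := fun z => -φ z) (x := x) (fun n => (hv n).neg)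
    (fun z ε hε => (hlim z).neg.eventually_le_const (lt_add_of_pos_right _ hε))
    (hlim x).neg hφ.neg (by simpa [neg_add_eq_sub] using hmin.neg)
  refine ⟨fun z => -ψ z, y, hψ.neg, ?_, hy, ?_⟩
  · rw [gradient_fun_neg, hgrad, gradient_fun_neg, neg_neg]
  · filter_upwards [hloc] with n hn
    simpa [add_comm] using hn.neg

end touching

/-- Coercivity of a continuous periodic convex Hamiltonian is uniform in the space variable:
convexity propagates a lower bound on a sphere to its exterior. -/
theorem exists_norm_le_of_le {N : ℕ} {F : Space N → Space N → ℝ}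
    (hc : Continuous fun z : Space N × Space N => F z.1 z.2)
    (hper : ∀ p, IsTorusPeriodic fun x => F x p) (hconv : ∀ x, ConvexOn ℝ Set.univ (F x))
    (hcoer : ∀ x, Tendsto (F x) (cocompact (Space N)) atTop) (h0 : ∀ x, F x 0 = 0) (C : ℝ) :
    ∃ R : NNReal, ∀ x p, F x p ≤ C → ‖p‖ ≤ R := by
  wlog hC : 0 ≤ C generalizing C
  · obtain ⟨R, hR⟩ := this 0 le_rfl
    exact ⟨R, fun x p h => hR x p (h.trans (not_le.1 hC).le)⟩
  obtain ⟨Q, hQ, hQp⟩ := exists_isCompact_forall_torusPeriodic N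
  suffices ∃ R : NNReal, ∀ x ∈ Q, ∀ p, F x p ≤ C → ‖p‖ ≤ R by
    obtain ⟨R, hR⟩ := this
    refine ⟨R, fun x p h => ?_⟩
    obtain ⟨y, hy, hxy⟩ := hQp x
    exact hR y hy p ((hxy _ (hper p)).symm.trans_le h)
  refine hQ.induction_on (p := fun s => ∃ R : NNReal, ∀ x ∈ s, ∀ p, F x p ≤ C → ‖p‖ ≤ R)
    ⟨0, by simp⟩ ?_ ?_ ?_
  · rintro s t hst ⟨R, hR⟩
    exact ⟨R, fun x hx => hR x (hst hx)⟩
  · rintro s t ⟨R, hR⟩ ⟨R', hR'⟩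
    refine ⟨max R R', fun x hx p h => ?_⟩
    rw [NNReal.coe_max]
    exact hx.elim (fun hx => (hR x hx p h).trans (le_max_left _ _))
      (fun hx => (hR' x hx p h).trans (le_max_right _ _))
  intro x _
  have hev := (hcoer x).eventually_gt_atTop C
  rw [← Metric.cobounded_eq_cocompact, (hasBasis_cobounded_norm).eventually_iff] at hev
  obtain ⟨ρ, -, hρ⟩ := hev
  set r : NNReal := ⟨max ρ 1, by positivity⟩
  have hr : (0 : ℝ) < r := lt_of_lt_of_le one_pos (le_max_right ρ 1)
  have hloc : ∀ᶠ y in 𝓝 x, ∀ q ∈ Metric.sphere (0 : Space N) r, C < F y q := by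
    refine (isCompact_sphere _ _).eventually_forall_of_forall_eventually fun q hq => ?_
    refine (hc.tendsto (x, q)).eventually_const_lt (hρ ?_)
    rw [mem_sphere_zero_iff_norm] at hq
    exact (le_max_left ρ 1).trans hq.ge
  refine ⟨_, mem_nhdsWithin_of_mem_nhds hloc, r, fun y hy p hp => ?_⟩
  by_contra! hlt
  have hp0 : 0 < ‖p‖ := hr.trans hlt
  have hq := hy (((r : ℝ) / ‖p‖) • p) (by
    rw [mem_sphere_zero_iff_norm, norm_smul, Real.norm_of_nonneg (by positivity),
      div_mul_cancel₀ _ hp0.ne'])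
  have h1 : (r : ℝ) / ‖p‖ ≤ 1 := (div_le_one hp0).2 hlt.le
  have h2 := (hconv y).2 (Set.mem_univ p) (Set.mem_univ 0)
    (show (0 : ℝ) ≤ r / ‖p‖ by positivity) (sub_nonneg.2 h1) (add_sub_cancel _ _)
  simp only [smul_zero, add_zero, h0, smul_eq_mul] at h2
  have h3 : (r : ℝ) / ‖p‖ * F y p ≤ r / ‖p‖ * C := by gcongr
  have h4 : (r : ℝ) / ‖p‖ * C ≤ C := mul_le_of_le_one_left hC h1
  linarith

/-! ### Perron's method -/

section perron
variable {m N : ℕ} {H : Fin m → Space N → Space N → ℝ} {A : Matrix (Fin m) (Fin m) ℝ}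

/-- The nonnegative continuous viscosity subsolutions of `H_i(x, Dv_i) + ∑_j a_ij v_j = 0` in
`ℝ^N`. Periodicity is not required, so that subsolutions may be modified locally. -/
def nonnegSubsolutions (H : Fin m → Space N → Space N → ℝ) (A : Matrix (Fin m) (Fin m) ℝ) :
    Set (Fin m → Space N → ℝ) :=
  {v | (∀ i, Continuous (v i)) ∧ (∀ i x, 0 ≤ v i x) ∧ IsViscositySubsolution H A (fun _ => 0) v}

/-- The pointwise supremum of all nonnegative continuous subsolutions (a junk value if this family
is empty or unbounded at a point). -/
noncomputable def perronEnvelope (H : Fin m → Space N → Space N → ℝ)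
    (A : Matrix (Fin m) (Fin m) ℝ) (i : Fin m) (x : Space N) : ℝ :=
  ⨆ v : nonnegSubsolutions H A, v.1 i x

theorem le_perronEnvelope {M : ℝ} (hM : ∀ v ∈ nonnegSubsolutions H A, ∀ i x, v i x ≤ M)
    {v : Fin m → Space N → ℝ} (hv : v ∈ nonnegSubsolutions H A) (i : Fin m) (x : Space N) :
    v i x ≤ perronEnvelope H A i x :=
  le_ciSup (f := fun v : nonnegSubsolutions H A => v.1 i x)
    ⟨M, by rintro _ ⟨v, rfl⟩; exact hM v.1 v.2 i x⟩ ⟨v, hv⟩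

theorem lipschitzWith_perronEnvelope {M : ℝ} {K : NNReal}
    (hM : ∀ v ∈ nonnegSubsolutions H A, ∀ i x, v i x ≤ M)
    (hK : ∀ v ∈ nonnegSubsolutions H A, ∀ i, LipschitzWith K (v i))
    (hne : (nonnegSubsolutions H A).Nonempty) (i : Fin m) :
    LipschitzWith K (perronEnvelope H A i) := by
  have := hne.to_subtype
  refine LipschitzWith.of_le_add_mul K fun x y => ciSup_le fun v => ?_
  exact ((hK v.1 v.2 i).le_add_mul x y).trans
    (add_le_add_left (le_perronEnvelope hM v.2 i y) _)

/-- The supremum of all subsolutions is a subsolution. -/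
theorem perronEnvelope_mem {M : ℝ} {K : NNReal}
    (hH : ∀ i, Continuous fun z : Space N × Space N => H i z.1 z.2)
    (hA : ∀ i j, i ≠ j → A i j ≤ 0)
    (hM : ∀ v ∈ nonnegSubsolutions H A, ∀ i x, v i x ≤ M)
    (hK : ∀ v ∈ nonnegSubsolutions H A, ∀ i, LipschitzWith K (v i))
    (hne : (nonnegSubsolutions H A).Nonempty) :
    perronEnvelope H A ∈ nonnegSubsolutions H A := by
  have hVc : ∀ i, Continuous (perronEnvelope H A i) := fun i =>
    (lipschitzWith_perronEnvelope hM hK hne i).continuous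
  have hinst := hne.to_subtype
  refine ⟨hVc, fun i x => ?_, fun i => (hVc i).upperSemicontinuous, fun φ hφ i x hmax => ?_⟩
  · obtain ⟨v, hv⟩ := hne
    exact (hv.2.1 i x).trans (le_perronEnvelope hM hv i x)
  have happrox : ∀ n : ℕ, ∃ v : nonnegSubsolutions H A,
      perronEnvelope H A i x - 1 / ((n : ℝ) + 1) < v.1 i x := fun n =>
    exists_lt_of_lt_ciSup (sub_lt_self _ Nat.one_div_pos_of_nat)
  choose v hv using happrox
  set l : Ultrafilter ℕ := hyperfilter ℕ
  have hl : (l : Filter ℕ) ≤ atTop := by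
    rw [← Nat.cofinite_eq_atTop]; exact hyperfilter_le_cofinite
  have hvx : Tendsto (fun n => (v n).1 i x) l (𝓝 (perronEnvelope H A i x)) := by
    refine tendsto_of_tendsto_of_tendsto_of_le_of_le (g := fun n : ℕ =>
      perronEnvelope H A i x - 1 / ((n : ℝ) + 1)) ?_ tendsto_const_nhds (fun n => (hv n).le)
      (fun n => le_perronEnvelope hM (v n).2 i x)
    simpa using (tendsto_one_div_add_atTop_nhds_zero_nat.mono_left hl).const_sub
      (perronEnvelope H A i x)
  obtain ⟨ψ, y, hψ, hgrad, hy, hvy, hloc⟩ := exists_touching_of_limit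
    (u := perronEnvelope H A i) (fun n => hK _ (v n).2 i) (fun z ε hε => Eventually.of_forall
      fun n => (le_perronEnvelope hM (v n).2 i z).trans (by linarith)) hvx hφ hmax
  have hlim : Tendsto (fun n => H i (y n) (gradient ψ (y n)) + (A i i * (v n).1 i (y n) +
      ∑ j ∈ Finset.univ.erase i, A i j * perronEnvelope H A j (y n))) l
      (𝓝 (H i x (gradient ψ x) + (A i i * perronEnvelope H A i x +
        ∑ j ∈ Finset.univ.erase i, A i j * perronEnvelope H A j x))) := by
    refine Tendsto.add (((hH i).tendsto (x, gradient ψ x)).comp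
      (hy.prodMk_nhds ((hψ.continuous_gradient.tendsto x).comp hy))) ?_
    refine (hvy.const_mul _).add (tendsto_finsetSum _ fun j _ => ?_)
    exact (((hVc j).tendsto x).comp hy).const_mul _
  rw [← hgrad, ← Finset.add_sum_erase _ _ (Finset.mem_univ i)]
  refine le_of_tendsto hlim ?_
  filter_upwards [hloc] with n hn
  have h1 := (v n).2.2.2.2 ψ hψ i (y n) hn
  rw [← Finset.add_sum_erase _ _ (Finset.mem_univ i)] at h1
  refine le_trans ?_ h1
  refine add_le_add_right (add_le_add_right (Finset.sum_le_sum fun j hj => ?_) _) _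
  exact mul_le_mul_of_nonpos_left (le_perronEnvelope hM (v n).2 j (y n))
    (hA i j (Finset.ne_of_mem_erase hj).symm)

theorem comp_add_mem_nonnegSubsolutions {a : Space N} (hHa : ∀ i x p, H i (x + a) p = H i x p)
    {v : Fin m → Space N → ℝ} (hv : v ∈ nonnegSubsolutions H A) :
    (fun i x => v i (x + a)) ∈ nonnegSubsolutions H A := by
  have hc : ∀ i, Continuous fun x => v i (x + a) := fun i =>
    (hv.1 i).comp (continuous_id.add continuous_const)
  refine ⟨hc, fun i x => hv.2.1 i _, fun i => (hc i).upperSemicontinuous,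
    fun φ hφ i x hmax => ?_⟩
  have hφ' : ContDiff ℝ 1 fun y => φ (y + -a) := hφ.comp (contDiff_id.add contDiff_const)
  have hmax' : IsLocalMax (fun y => v i y - φ (y + -a)) (x + a) := by
    have ht : Tendsto (fun y => y + -a) (𝓝 (x + a)) (𝓝 x) :=
      Continuous.tendsto' (by fun_prop) _ _ (by abel)
    filter_upwards [ht.eventually hmax] with y hy
    simpa [add_assoc] using hy
  have h := hv.2.2.2 _ hφ' i (x + a) hmax'
  rw [gradient_comp_add, hHa] at h
  simpa [add_assoc] using h

/-- The class of competitors is invariant under the translations that preserve `H`, hence so is its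
supremum. -/
theorem perronEnvelope_isTorusPeriodic {M : ℝ}
    (hM : ∀ v ∈ nonnegSubsolutions H A, ∀ i x, v i x ≤ M)
    (hne : (nonnegSubsolutions H A).Nonempty) (hHp : ∀ i p, IsTorusPeriodic fun x => H i x p)
    (i : Fin m) : IsTorusPeriodic (perronEnvelope H A i) := by
  have hinst := hne.to_subtype
  have key : ∀ a : Space N, (∀ i x p, H i (x + a) p = H i x p) → ∀ x,
      perronEnvelope H A i (x + a) ≤ perronEnvelope H A i x := fun a ha x =>
    ciSup_le fun v => le_perronEnvelope hM (comp_add_mem_nonnegSubsolutions ha v.2) i x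
  intro k x
  refine le_antisymm (key _ (fun i x p => hHp i p k x) x) ?_
  have h := key (-EuclideanSpace.single k 1) (fun i x p => (hHp i p k).neg x)
    (x + EuclideanSpace.single k 1)
  simpa using h

/-- The supremum of all subsolutions is a supersolution: where this fails, one component can be
raised near the point of failure to the maximum with a test function. As the off-diagonal entries
of the coupling are nonpositive, raising one component does not harm the other equations. -/
theorem perronEnvelope_supersolution {M : ℝ} {K : NNReal}
    (hH : ∀ i, Continuous fun z : Space N × Space N => H i z.1 z.2)
    (hA : ∀ i j, i ≠ j → A i j ≤ 0)
    (hM : ∀ v ∈ nonnegSubsolutions H A, ∀ i x, v i x ≤ M)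
    (hK : ∀ v ∈ nonnegSubsolutions H A, ∀ i, LipschitzWith K (v i))
    (hne : (nonnegSubsolutions H A).Nonempty) :
    IsViscositySupersolution H A (fun _ => 0) (perronEnvelope H A) := by
  obtain ⟨hVc, hV0, -, hVsub⟩ := perronEnvelope_mem hH hA hM hK hne
  have hmaximal : ∀ v ∈ nonnegSubsolutions H A, ∀ i x, v i x ≤ perronEnvelope H A i x :=
    fun v hv => le_perronEnvelope hM hv
  set V := perronEnvelope H A
  refine ⟨fun i => (hVc i).lowerSemicontinuous, fun φ hφ i x hmin => ?_⟩
  by_contra! hneg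
  have hq := contDiff_mul_norm_sub_sq (-1) x
  -- `χ` touches `V i` strictly from below at `x`, and `χ + δ` is the function to be glued in.
  set χ : Space N → ℝ := fun y => φ y + -1 * ‖y - x‖ ^ 2 + (V i x - φ x) with hχdef
  have hχ : ContDiff ℝ 1 χ := (hφ.add hq).add contDiff_const
  have hχx : χ x = V i x := by simp [hχdef]
  have hχgrad : gradient χ x = gradient φ x := by
    rw [hχdef, gradient_add_of_contDiff (hφ.add hq) contDiff_const,
      gradient_add_of_contDiff hφ hq, gradient_mul_norm_sub_sq, gradient_fun_const]
    simp
  let E : Space N × ℝ → ℝ := fun z => H i z.1 (gradient χ z.1) + (A i i * (χ z.1 + z.2) +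
    ∑ j ∈ Finset.univ.erase i, A i j * V j z.1)
  have hE : Continuous E := by
    refine ((hH i).comp (continuous_fst.prodMk (hχ.continuous_gradient.comp continuous_fst))).add
      ((continuous_const.mul ((hχ.continuous.comp continuous_fst).add continuous_snd)).add
        (continuous_finsetSum _ fun j _ => continuous_const.mul ((hVc j).comp continuous_fst)))
  have hE0 : E (x, 0) < 0 := by
    simp only [E, hχgrad, hχx, add_zero]
    rwa [Finset.add_sum_erase _ (fun j => A i j * V j x) (Finset.mem_univ i)]
  have hEev : ∀ᶠ z in 𝓝 x ×ˢ 𝓝 (0 : ℝ), E z < 0 := by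
    rw [← nhds_prod_eq]; exact (hE.tendsto _).eventually_lt_const hE0
  obtain ⟨pa, hpa, pb, hpb, hab⟩ := eventually_prod_iff.1 hEev
  obtain ⟨r, hr, hball⟩ := Metric.nhds_basis_closedBall.eventually_iff.1 (hpa.and hmin)
  obtain ⟨s, hs, hsball⟩ := Metric.nhds_basis_closedBall.eventually_iff.1 hpb
  obtain ⟨δ, hδ, hδs, hδr⟩ : ∃ δ : ℝ, 0 < δ ∧ δ ≤ s ∧ δ < r ^ 2 :=
    ⟨min s (r ^ 2 / 2), by positivity, min_le_left _ _,
      (min_le_right _ _).trans_lt (half_lt_self (by positivity))⟩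
  set ψ : Space N → ℝ := fun y => χ y + δ with hψdef
  have hψ : ContDiff ℝ 1 ψ := hχ.add contDiff_const
  have hψgrad : ∀ y, gradient ψ y = gradient χ y := fun y => by
    rw [hψdef, gradient_add_of_contDiff hχ contDiff_const, gradient_fun_const, add_zero]
  have hstrict : ∀ y, ‖y - x‖ ≤ r → V i y < ψ y → ‖y - x‖ < r := by
    intro y hy hlt
    refine lt_of_le_of_ne hy fun heq => ?_
    have h1 : V i x - φ x ≤ V i y - φ y := (hball (by simpa [dist_eq_norm] using hy)).2
    simp only [hψdef, hχdef, heq] at hlt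
    linarith
  set W : Space N → ℝ := fun y => if ‖y - x‖ ≤ r then max (V i y) (ψ y) else V i y with hWdef
  have hWc : Continuous W := by
    refine Continuous.if_le ((hVc i).max hψ.continuous) (hVc i) (by fun_prop) continuous_const ?_
    intro y hy
    exact max_eq_left (not_lt.1 fun h => (hstrict y hy.le h).ne hy)
  have hVW : ∀ y, V i y ≤ W y := by
    intro y
    simp only [hWdef]
    split_ifs
    exacts [le_max_left _ _, le_rfl]
  have hmem : Function.update V i W ∈ nonnegSubsolutions H A := by
    have hc : ∀ j, Continuous (Function.update V i W j) := fun j => by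
      by_cases h : j = i
      · subst h; simpa using hWc
      · simpa [h] using hVc j
    have hle : ∀ j y, V j y ≤ Function.update V i W j y := fun j y => by
      by_cases h : j = i
      · subst h; simpa using hVW y
      · simp [h]
    refine ⟨hc, fun j y => (hV0 j y).trans (hle j y), fun j => (hc j).upperSemicontinuous,
      fun θ hθ k y hmax => ?_⟩
    by_cases hVk : Function.update V i W k y = V k y
    · have hmax' : IsLocalMax (fun z => V k z - θ z) y := by
        filter_upwards [hmax] with z hz
        have := hle k z
        simp only [hVk] at hz
        linarith
      refine le_trans ?_ (hVsub θ hθ k y hmax')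
      refine add_le_add_right (Finset.sum_le_sum fun j _ => ?_) _
      by_cases hkj : k = j
      · subst hkj; rw [hVk]
      · exact mul_le_mul_of_nonpos_left (hle j y) (hA k j hkj)
    · obtain rfl : k = i := by
        by_contra h
        exact hVk (by simp [h])
      simp only [Function.update_self] at hVk hmax
      have hyr : ‖y - x‖ ≤ r := by
        by_contra h
        exact hVk (by simp [hWdef, h])
      have hWy : W y = max (V k y) (ψ y) := by simp [hWdef, hyr]
      have hlt : V k y < ψ y := by
        by_contra h
        exact hVk (by rw [hWy, max_eq_left (not_lt.1 h)])
      have hWψ : W y = ψ y := by rw [hWy, max_eq_right hlt.le]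
      have hnear : ∀ᶠ z in 𝓝 y, ‖z - x‖ < r :=
        (Continuous.tendsto (by fun_prop : Continuous fun z => ‖z - x‖) y).eventually_lt_const
          (hstrict y hyr hlt)
      have hψmax : IsLocalMax (fun z => ψ z - θ z) y := by
        filter_upwards [hmax, hnear] with z hz hzr
        have h1 : ψ z ≤ W z := by simp [hWdef, hzr.le]
        simp only [hWψ] at hz
        linarith
      rw [← gradient_eq_of_isLocalMax_sub hψ hθ hψmax, hψgrad]
      have hEy : E (y, δ) < 0 := hab (hball (by simpa [dist_eq_norm] using hyr)).1
        (hsball (by simpa [abs_of_pos hδ] using hδs))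
      rw [← Finset.add_sum_erase _ _ (Finset.mem_univ k), Function.update_self, hWψ]
      refine le_trans (le_of_eq ?_) hEy.le
      simp only [E, hψdef]
      congr 2
      refine Finset.sum_congr rfl fun j hj => ?_
      rw [Function.update_of_ne (Finset.ne_of_mem_erase hj)]
  have h1 := hmaximal _ hmem i x
  have h2 : ψ x ≤ W x := by simp [hWdef, hr.le]
  simp only [Function.update_self, hψdef, hχx] at h1 h2
  linarith

end perron

/-! ### The discounted problem -/

section eikonal
variable {m N : ℕ} {D : Matrix (Fin m) (Fin m) ℝ} {F : Fin m → Space N → Space N → ℝ}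
  {f : Fin m → Space N → ℝ}

theorem IsEikonalSystem.continuous_hamiltonian (h : IsEikonalSystem F f) (i : Fin m) :
    Continuous fun z : Space N × Space N => F i z.1 z.2 - f i z.1 :=
  (h.continuous_F i).sub ((h.continuous_f i).comp continuous_fst)

/-- Since `F ≥ 0`, the zeroth order part of the subsolution inequality holds at every point. -/
theorem IsEikonalSystem.sum_mul_le (h : IsEikonalSystem F f) {A : Matrix (Fin m) (Fin m) ℝ}
    {c : Fin m → ℝ} {v : Fin m → Space N → ℝ} (hc : ∀ i, Continuous (v i))
    (hv : IsViscositySubsolution (fun i x p => F i x p - f i x) A c v) (i : Fin m) (x : Space N) :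
    ∑ j, A i j * v j x ≤ f i x + c i := by
  have := forall_nonpos_of_touching (G := fun x => ∑ j, A i j * v j x - (f i x + c i)) (hc i)
    ((continuous_finsetSum _ fun j _ => continuous_const.mul (hc j)).sub
      ((h.continuous_f i).add continuous_const))
    (fun φ hφ y hy => by
      have h1 := hv.2 φ hφ i y hy
      have h2 := h.F_nonneg i y (gradient φ y)
      linarith) x
  linarith

/-- A common radius for the sublevel sets of all the `F i x`. -/
theorem IsEikonalSystem.exists_norm_le (h : IsEikonalSystem F f) (C : ℝ) :
    ∃ R : NNReal, ∀ i x p, F i x p ≤ C → ‖p‖ ≤ R := by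
  choose R hR using fun i => exists_norm_le_of_le (h.continuous_F i) (h.periodic_F i)
    (h.convex_F i) (h.coercive_F i) (h.F_zero i) C
  obtain ⟨M, hM⟩ := (Set.finite_range R).bddAbove
  exact ⟨M, fun i x p hp => (hR i x p hp).trans (NNReal.coe_le_coe.2 (hM ⟨i, rfl⟩))⟩

/-- Every discounted problem has a periodic solution, with a Lipschitz constant and bounds that do
not depend on the discount factor `ε`. -/
theorem exists_discounted_solution (h : IsEikonalSystem F f) (hD : IsCouplingMatrix D)
    {Λ : Fin m → ℝ} (hΛ : IsPositiveLeftNull D Λ) :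
    ∃ (K : NNReal) (C : ℝ), 0 ≤ C ∧ ∀ ε > 0, ∃ v : Fin m → Space N → ℝ,
      (∀ i, LipschitzWith K (v i)) ∧ (∀ i, IsTorusPeriodic (v i)) ∧
      (∀ i x, ε * v i x ∈ Set.Icc 0 C) ∧ (∀ i x, |∑ j, D i j * v j x| ≤ C) ∧
      IsViscositySubsolution (fun i x p => F i x p - f i x) (D + ε • 1) (fun _ => 0) v ∧
      IsViscositySupersolution (fun i x p => F i x p - f i x) (D + ε • 1) (fun _ => 0) v := by
  obtain ⟨B, hB, hf⟩ := exists_forall_abs_le h.periodic_f h.continuous_f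
  obtain ⟨C, hC, hDC⟩ := exists_abs_sum_mul_le_of_sum_mul_le hΛ hB
  obtain ⟨K, hK⟩ := h.exists_norm_le (B + C)
  refine ⟨K, B + C, by positivity, fun ε hε => ?_⟩
  set A : Matrix (Fin m) (Fin m) ℝ := D + ε • 1
  set S := nonnegSubsolutions (fun i x p => F i x p - f i x) A
  have hA : ∀ i (u : Fin m → ℝ), ∑ j, A i j * u j = ∑ j, D i j * u j + ε * u i := by
    intro i u
    simp [A, Matrix.add_apply, Matrix.one_apply, add_mul, Finset.sum_add_distrib]
  have hle : ∀ v ∈ S, ∀ i x, ∑ j, D i j * v j x + ε * v i x ≤ B := fun v hv i x => by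
    have h1 := h.sum_mul_le hv.1 hv.2.2 i x
    rw [hA] at h1
    linarith [(abs_le.1 (hf i x)).2]
  have hDv : ∀ v ∈ S, ∀ i x, |∑ j, D i j * v j x| ≤ C := fun v hv i x =>
    hDC (fun j => v j x) (fun k => by
      have := mul_nonneg hε.le (hv.2.1 k x)
      linarith [hle v hv k x]) i
  have hbd : ∀ v ∈ S, ∀ i x, ε * v i x ≤ B + C := fun v hv i x => by
    linarith [hle v hv i x, (abs_le.1 (hDv v hv i x)).1]
  have hM : ∀ v ∈ S, ∀ i x, v i x ≤ (B + C) / ε := fun v hv i x =>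
    (le_div_iff₀' hε).2 (hbd v hv i x)
  have hLip : ∀ v ∈ S, ∀ i, LipschitzWith K (v i) := by
    intro v hv i
    refine lipschitzWith_of_touching (M := (B + C) / ε) (hv.1 i) (fun x => ?_)
      fun φ hφ x hmax => hK i x _ ?_
    · rw [abs_of_nonneg (hv.2.1 i x)]
      exact hM v hv i x
    · have h1 := hv.2.2.2 φ hφ i x hmax
      rw [hA] at h1
      have h2 := mul_nonneg hε.le (hv.2.1 i x)
      linarith [(abs_le.1 (hDv v hv i x)).1, (abs_le.1 (hf i x)).2]
  have hne : S.Nonempty := by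
    refine ⟨fun _ _ => 0, fun i => continuous_const, fun i x => le_rfl,
      fun i => continuous_const.upperSemicontinuous, fun φ hφ i x hmax => ?_⟩
    have hgrad := gradient_eq_of_isLocalMax_sub contDiff_const hφ hmax
    rw [gradient_fun_const] at hgrad
    simpa [← hgrad, h.F_zero] using h.f_nonneg i x
  have hoff : ∀ i j, i ≠ j → A i j ≤ 0 := fun i j hij => by
    simpa [A, Matrix.one_apply, hij] using hD.offDiag_nonpos i j hij
  have hH := h.continuous_hamiltonian
  have hmem := perronEnvelope_mem hH hoff hM hLip hne
  refine ⟨_, hLip _ hmem, perronEnvelope_isTorusPeriodic hM hne fun i p k x => ?_,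
    fun i x => ⟨mul_nonneg hε.le (hmem.2.1 i x), hbd _ hmem i x⟩,
    fun i x => (hDv _ hmem i x).trans (le_add_of_nonneg_left hB), hmem.2.2,
    perronEnvelope_supersolution hH hoff hM hLip hne⟩
  have h1 := h.periodic_F i p k x
  have h2 := h.periodic_f i k x
  simp only at h1
  simp only [h1, h2]

/-! ### The vanishing discount limit -/

theorem exists_ergodicSolution (hm : 0 < m) (h : IsEikonalSystem F f) (hD : IsCouplingMatrix D)
    (hrow : ∀ i, ∑ j, D i j = 0) (hirr : IsIrreducibleCoupling D) :
    ∃ (c : ℝ) (v : Fin m → Space N → ℝ),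
      IsErgodicSolution (fun i x p => F i x p - f i x) D (fun _ => c) v ∧
      ∃ K : NNReal, ∀ i, LipschitzWith K (v i) := by
  obtain ⟨Λ, hΛ⟩ := exists_isPositiveLeftNull hm hD hrow hirr
  obtain ⟨K, C, hC, hsol⟩ := exists_discounted_solution h hD hΛ
  set ε : ℕ → ℝ := fun n => 1 / ((n : ℝ) + 1) with hεdef
  have hε : ∀ n, 0 < ε n := fun n => Nat.one_div_pos_of_nat
  choose v hvK hvp hvb hvD hsub hsup using fun n => hsol (ε n) (hε n)
  set l : Ultrafilter ℕ := hyperfilter ℕ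
  have hl : (l : Filter ℕ) ≤ atTop := by
    rw [← Nat.cofinite_eq_atTop]; exact hyperfilter_le_cofinite
  have hε0 : Tendsto ε l (𝓝 0) := tendsto_one_div_add_atTop_nhds_zero_nat.mono_left hl
  let k : Fin m := ⟨0, hm⟩
  -- The solutions blow up in general; normalizing one value makes them locally bounded.
  set w : ℕ → Fin m → Space N → ℝ := fun n i x => v n i x - v n k 0 with hwdef
  have hwK : ∀ i n, LipschitzWith K (w n i) := fun i n => by
    simpa [hwdef] using (hvK n i).sub (LipschitzWith.const (v n k 0))
  have hvw : ∀ n i x, ∑ j, (D + ε n • (1 : Matrix (Fin m) (Fin m) ℝ)) i j * v n j x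
      = ∑ j, D i j * w n j x + ε n * v n i x := by
    intro n i x
    simp [hwdef, Matrix.add_apply, Matrix.one_apply, add_mul, mul_sub, Finset.sum_add_distrib,
      Finset.sum_sub_distrib, ← Finset.sum_mul, hrow]
  obtain ⟨C', hC'⟩ := exists_abs_sub_le_of_abs_mulVec_le hD hrow hirr k hC
  have hwb : ∀ i x n, w n i x ∈ Set.Icc (-(C' + K * ‖x‖)) (C' + K * ‖x‖) := by
    intro i x n
    have h1 := hC' (fun j => v n j x) (fun i => hvD n i x) i
    have h2 := (hvK n k).dist_le_mul x 0
    rw [Real.dist_eq, dist_zero_right] at h2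
    refine abs_le.1 ?_
    calc |w n i x| = |(v n i x - v n k x) + (v n k x - v n k 0)| := by simp [hwdef]
      _ ≤ _ := (abs_add_le _ _).trans (add_le_add h1 h2)
  have hlimit : ∀ i x, ∃ t, Tendsto (fun n => w n i x) l (𝓝 t) := fun i x => by
    obtain ⟨t, -, ht⟩ := isCompact_Icc.ultrafilter_le_nhds' (l.map fun n => w n i x)
      (Ultrafilter.mem_map.2 (Eventually.of_forall (hwb i x)))
    exact ⟨t, ht⟩
  choose u hu using hlimit
  obtain ⟨a, ha⟩ : ∃ a, Tendsto (fun n => ε n * v n k 0) l (𝓝 a) := by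
    obtain ⟨t, -, ht⟩ := isCompact_Icc.ultrafilter_le_nhds' (l.map fun n => ε n * v n k 0)
      (Ultrafilter.mem_map.2 (Eventually.of_forall fun n => hvb n k 0))
    exact ⟨t, ht⟩
  have huK : ∀ i, LipschitzWith K (u i) := fun i => by
    refine LipschitzWith.of_le_add_mul K fun x y => ?_
    exact le_of_tendsto_of_tendsto' (hu i x) ((hu i y).add_const _)
      fun n => (hwK i n).le_add_mul x y
  -- The left-hand sides of the discounted equations converge along converging points.
  have hconv : ∀ i (ψ : Space N → ℝ) x (y : ℕ → Space N), ContDiff ℝ 1 ψ → Tendsto y l (𝓝 x) →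
      Tendsto (fun n => F i (y n) (gradient ψ (y n)) - f i (y n) +
        ∑ j, (D + ε n • (1 : Matrix (Fin m) (Fin m) ℝ)) i j * v n j (y n)) l
        (𝓝 (F i x (gradient ψ x) - f i x + (∑ j, D i j * u j x + a))) := by
    intro i ψ x y hψ hy
    have hw : ∀ j, Tendsto (fun n => w n j (y n)) l (𝓝 (u j x)) := fun j =>
      tendsto_apply_of_lipschitzWith (hwK j) (hu j x) hy
    refine Tendsto.add (((h.continuous_hamiltonian i).tendsto (x, gradient ψ x)).comp
      (hy.prodMk_nhds ((hψ.continuous_gradient.tendsto x).comp hy))) ?_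
    simp_rw [hvw]
    refine (tendsto_finsetSum _ fun j _ => (hw j).const_mul _).add ?_
    have h1 := (hε0.mul (hw i)).add ha
    rw [zero_mul, zero_add] at h1
    refine h1.congr fun n => ?_
    simp only [hwdef]
    ring
  refine ⟨-a, u, ⟨fun i => (huK i).continuous, fun i e x => ?_,
    ⟨fun i => (huK i).continuous.upperSemicontinuous, fun φ hφ i x hmax => ?_⟩,
    ⟨fun i => (huK i).continuous.lowerSemicontinuous, fun φ hφ i x hmin => ?_⟩⟩, K, huK⟩
  · refine tendsto_nhds_unique (hu i _) ((hu i x).congr fun n => ?_)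
    simp only [hwdef, hvp n i e x]
  · obtain ⟨ψ, y, hψ, hgrad, hy, -, hloc⟩ := exists_touching_of_limit (hwK i)
      (fun z δ hδ => (hu i z).eventually_le_const (lt_add_of_pos_right _ hδ)) (hu i x) hφ hmax
    have h1 : F i x (gradient ψ x) - f i x + (∑ j, D i j * u j x + a) ≤ 0 := by
      refine le_of_tendsto (hconv i ψ x y hψ hy) ?_
      filter_upwards [hloc] with n hn
      refine (hsub n).2 ψ hψ i (y n) ?_
      filter_upwards [hn] with z hz
      simp only [hwdef] at hz
      linarith
    rw [hgrad] at h1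
    linarith
  · obtain ⟨ψ, y, hψ, hgrad, hy, hloc⟩ := exists_touching_below_of_limit (hwK i) (hu i) hφ hmin
    have h1 : 0 ≤ F i x (gradient ψ x) - f i x + (∑ j, D i j * u j x + a) := by
      refine ge_of_tendsto (hconv i ψ x y hψ hy) ?_
      filter_upwards [hloc] with n hn
      refine (hsup n).2 ψ hψ i (y n) ?_
      filter_upwards [hn] with z hz
      simp only [hwdef] at hz
      linarith
    rw [hgrad] at h1
    linarith

end eikonal

/-! ### Comparison and the bounds on the ergodic constant -/

section comparison
variable {m N : ℕ} {D : Matrix (Fin m) (Fin m) ℝ} {F : Fin m → Space N → Space N → ℝ}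
  {f : Fin m → Space N → ℝ}

/-- Doubling of variables: the penalized differences `v i x - w i (x + z) - a |z|²` attain a common
maximum over all indices and all points. -/
theorem exists_forall_doubling_le (hm : 0 < m) {v w : Fin m → Space N → ℝ}
    (hvc : ∀ i, Continuous (v i)) (hvp : ∀ i, IsTorusPeriodic (v i))
    (hwc : ∀ i, Continuous (w i)) (hwp : ∀ i, IsTorusPeriodic (w i))
    {Q : Set (Space N)} (hQ : IsCompact Q)
    (hQp : ∀ x, ∃ y ∈ Q, ∀ g : Space N → ℝ, IsTorusPeriodic g → g x = g y) {a : ℝ} (ha : 1 ≤ a) :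
    ∃ i, ∃ x ∈ Q, ∃ z, ∀ j y t,
      v j y - w j (y + t) - a * ‖t‖ ^ 2 ≤ v i x - w i (x + z) - a * ‖z‖ ^ 2 := by
  have : Nonempty (Fin m) := ⟨⟨0, hm⟩⟩
  obtain ⟨M, hM, hvM⟩ := exists_forall_abs_le hvp hvc
  obtain ⟨M', hM', hwM⟩ := exists_forall_abs_le hwp hwc
  obtain ⟨q, hq, -⟩ := hQp 0
  set g : Fin m → Space N × Space N → ℝ := fun i z => v i z.1 - w i (z.1 + z.2) - a * ‖z.2‖ ^ 2
  have hg : ∀ i, Continuous (g i) := fun i =>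
    (((hvc i).comp continuous_fst).sub ((hwc i).comp (continuous_fst.add continuous_snd))).sub
      (continuous_const.mul (continuous_snd.norm.pow 2))
  -- Outside this radius the penalty exceeds the oscillation of `v i - w i`.
  set ρ : ℝ := 2 * (M + M') + 1
  have hρ : 0 ≤ ρ := by positivity
  choose s hs hmax using fun i => (hQ.prod (isCompact_closedBall (0 : Space N) ρ)).exists_isMaxOn
    ⟨(q, 0), hq, Metric.mem_closedBall_self hρ⟩ (hg i).continuousOn
  obtain ⟨i, hi⟩ := Finite.exists_max fun i => g i (s i)
  have key : ∀ j y t, ‖t‖ ≤ ρ → g j (y, t) ≤ g i (s i) := by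
    intro j y t ht
    obtain ⟨y', hy', hyy⟩ := hQp y
    have h1 : g j (y, t) = g j (y', t) := hyy (fun y => g j (y, t)) fun k y => by
      have h2 := hvp j k y
      have h3 := hwp j k (y + t)
      simp only [g, h2, add_right_comm y _ t, h3]
    rw [h1]
    exact (hmax j (show (y', t) ∈ Q ×ˢ Metric.closedBall 0 ρ from
      ⟨hy', by simpa using ht⟩)).trans (hi j)
  refine ⟨i, (s i).1, (hs i).1, (s i).2, fun j y t => ?_⟩
  rcases le_or_gt ‖t‖ ρ with ht | ht
  · exact key j y t ht
  · refine le_trans ?_ (key j y 0 (by simpa using hρ))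
    have h1 := abs_le.1 (hvM j y)
    have h2 := abs_le.1 (hwM j y)
    have h3 := abs_le.1 (hwM j (y + t))
    have h4 : ρ ≤ a * ‖t‖ ^ 2 := by nlinarith [norm_nonneg t]
    simp only [g, add_zero, norm_zero]
    norm_num
    linarith

/-- Comparison of constants: a periodic subsolution with constant `c` and a periodic supersolution
with constant `c'` can coexist only if `c' ≤ c`. The slopes occurring in the doubling of variables
stay bounded by coercivity, and the coupling terms compare favourably because the index is part of
the maximization. -/
theorem le_of_subsolution_of_supersolution (hm : 0 < m) (h : IsEikonalSystem F f)
    (hD : IsCouplingMatrix D) (hrow : ∀ i, ∑ j, D i j = 0) {v w : Fin m → Space N → ℝ} {c c' : ℝ}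
    (hvc : ∀ i, Continuous (v i)) (hvp : ∀ i, IsTorusPeriodic (v i))
    (hwc : ∀ i, Continuous (w i)) (hwp : ∀ i, IsTorusPeriodic (w i))
    (hv : IsViscositySubsolution (fun i x p => F i x p - f i x) D (fun _ => c) v)
    (hw : IsViscositySupersolution (fun i x p => F i x p - f i x) D (fun _ => c') w) :
    c' ≤ c := by
  obtain ⟨Q, hQ, hQp⟩ := exists_isCompact_forall_torusPeriodic N
  obtain ⟨B, -, hB⟩ := exists_forall_abs_le (g := fun i x => f i x + c - ∑ j, D i j * v j x)
    (fun i k x => by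
      have h1 := h.periodic_f i k x
      have h2 : ∀ j, v j (x + EuclideanSpace.single k 1) = v j x := fun j => hvp j k x
      simp only [h1, h2])
    (fun i => ((h.continuous_f i).add continuous_const).sub
      (continuous_finsetSum _ fun j _ => continuous_const.mul (hvc j)))
  obtain ⟨R, hR⟩ := h.exists_norm_le B
  have hdoubling : ∀ n : ℕ, ∃ i, ∃ x ∈ Q, ∃ z p : Space N,
      ‖p‖ ≤ R ∧ ‖z‖ ≤ R * (1 / ((n : ℝ) + 1)) ∧
      c' - c ≤ (F i (x + z) p - f i (x + z)) - (F i x p - f i x) := by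
    intro n
    set a : ℝ := (n : ℝ) + 1
    have ha : 1 ≤ a := by simp [a]
    obtain ⟨i, x, hx, z, hmax⟩ := exists_forall_doubling_le hm hvc hvp hwc hwp hQ hQp ha
    have hsub := hv.2 _ (contDiff_mul_norm_sub_sq a (x + z)) i x (Eventually.of_forall fun y => by
      have h1 := hmax i y (x + z - y)
      simp only [add_sub_cancel] at h1
      rw [norm_sub_rev] at h1
      simp only [sub_add_cancel_left, norm_neg]
      linarith)
    have hsup := hw.2 _ (contDiff_mul_norm_sub_sq (-a) x) i (x + z)
      (Eventually.of_forall fun y => by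
        have h1 := hmax i x (y - x)
        simp only [add_sub_cancel] at h1
        simp only [add_sub_cancel_left]
        linarith)
    rw [gradient_mul_norm_sub_sq] at hsub hsup
    have hp : (2 * -a) • (x + z - x) = (2 * a) • (x - (x + z)) := by
      rw [add_sub_cancel_left, sub_add_cancel_left, mul_neg, neg_smul, smul_neg]
    rw [hp] at hsup
    set p := (2 * a) • (x - (x + z)) with hpdef
    have hpR : ‖p‖ ≤ R := hR i x p (by linarith [(abs_le.1 (hB i x)).2])
    refine ⟨i, x, hx, z, p, hpR, ?_, ?_⟩
    · rw [mul_one_div, le_div_iff₀' (by positivity)]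
      rw [hpdef, norm_smul, sub_add_cancel_left, norm_neg, Real.norm_of_nonneg (by positivity)]
        at hpR
      have : 0 ≤ a * ‖z‖ := by positivity
      linarith
    · have hsum : ∑ j, D i j * w j (x + z) ≤ ∑ j, D i j * v j x := by
        have h1 : ∑ j, D i j * (v j x - w j (x + z) - (v i x - w i (x + z)))
            = ∑ j, D i j * v j x - ∑ j, D i j * w j (x + z) := by
          simp_rw [mul_sub, Finset.sum_sub_distrib, ← Finset.sum_mul, hrow]
          ring
        have h2 : 0 ≤ ∑ j, D i j * (v j x - w j (x + z) - (v i x - w i (x + z))) := by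
          refine Finset.sum_nonneg fun j _ => ?_
          by_cases hij : i = j
          · simp [hij]
          · exact mul_nonneg_of_nonpos_of_nonpos (hD.offDiag_nonpos i j hij)
              (by linarith [hmax j x z])
        linarith
      linarith
  choose i x hx z p hpR hz hineq using hdoubling
  set l : Ultrafilter ℕ := hyperfilter ℕ
  have hl : (l : Filter ℕ) ≤ atTop := by
    rw [← Nat.cofinite_eq_atTop]; exact hyperfilter_le_cofinite
  have hcomp : IsCompact ((Set.univ : Set (Fin m)) ×ˢ (Q ×ˢ Metric.closedBall (0 : Space N) R)) :=
    isCompact_univ.prod (hQ.prod (isCompact_closedBall _ _))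
  obtain ⟨⟨i₀, x₀, p₀⟩, -, hlim⟩ := hcomp.ultrafilter_le_nhds' (l.map fun n => (i n, x n, p n))
    (Ultrafilter.mem_map.2 (Eventually.of_forall fun n =>
      ⟨Set.mem_univ _, hx n, by simpa using hpR n⟩))
  replace hlim : Tendsto (fun n => (i n, x n, p n)) l (𝓝 (i₀, x₀, p₀)) := hlim
  have hi := (continuous_fst.tendsto _).comp hlim
  have hxl := ((continuous_fst.comp continuous_snd).tendsto _).comp hlim
  have hpl := ((continuous_snd.comp continuous_snd).tendsto _).comp hlim
  have hzl : Tendsto z l (𝓝 0) := by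
    refine squeeze_zero_norm hz ?_
    simpa using (tendsto_one_div_add_atTop_nhds_zero_nat.mono_left hl).const_mul (R : ℝ)
  have hG : Continuous fun s : Fin m × Space N × Space N => F s.1 s.2.1 s.2.2 - f s.1 s.2.1 :=
    continuous_prod_of_discrete_left.2 h.continuous_hamiltonian
  have hxz : Tendsto (fun n => x n + z n) l (𝓝 x₀) := by simpa using hxl.add hzl
  have h1 := ((hG.tendsto (i₀, x₀, p₀)).comp (hi.prodMk_nhds (hxz.prodMk_nhds hpl))).sub
    ((hG.tendsto (i₀, x₀, p₀)).comp (hi.prodMk_nhds (hxl.prodMk_nhds hpl)))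
  rw [sub_self] at h1
  exact sub_nonpos.1 (ge_of_tendsto' h1 hineq)

theorem neg_mul_sum_le (h : IsEikonalSystem F f) {Λ : Fin m → ℝ} (hΛ : IsPositiveLeftNull D Λ)
    {c : ℝ} {v : Fin m → Space N → ℝ} (hvc : ∀ i, Continuous (v i))
    (hv : IsViscositySubsolution (fun i x p => F i x p - f i x) D (fun _ => c) v) (x : Space N) :
    -c * ∑ i, Λ i ≤ ∑ i, Λ i * f i x := by
  have h1 : ∑ i, Λ i * ∑ j, D i j * v j x ≤ ∑ i, Λ i * (f i x + c) :=
    Finset.sum_le_sum fun i _ => mul_le_mul_of_nonneg_left (h.sum_mul_le hvc hv i x) (hΛ.1 i).le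
  rw [sum_mul_sum_eq_zero hΛ] at h1
  simp_rw [mul_add, Finset.sum_add_distrib, ← Finset.sum_mul] at h1
  linarith

/-- The supersolution inequality is tested with constants at minimum points of the components. -/
theorem sum_mul_le_neg_mul_sum (h : IsEikonalSystem F f) (hD : IsCouplingMatrix D)
    {Λ : Fin m → ℝ} (hΛ : IsPositiveLeftNull D Λ) {c : ℝ} {v : Fin m → Space N → ℝ}
    (hvc : ∀ i, Continuous (v i)) (hvp : ∀ i, IsTorusPeriodic (v i))
    (hv : IsViscositySupersolution (fun i x p => F i x p - f i x) D (fun _ => c) v)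
    {μ : Fin m → ℝ} (hμ : ∀ i x, μ i ≤ f i x) :
    ∑ i, Λ i * μ i ≤ -c * ∑ i, Λ i := by
  choose x hx using fun i => (hvp i).exists_isLeast (hvc i)
  have hmin : ∀ i y, v i (x i) ≤ v i y := fun i y => (hx i).2 ⟨y, rfl⟩
  have h1 : ∀ i, μ i + c ≤ ∑ j, D i j * v j (x j) := by
    intro i
    have h2 := hv.2 (fun _ => 0) contDiff_const i (x i)
      (Eventually.of_forall fun y => by simpa using hmin i y)
    simp only [gradient_fun_const, h.F_zero] at h2
    have h3 : ∑ j, D i j * v j (x i) ≤ ∑ j, D i j * v j (x j) := by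
      refine Finset.sum_le_sum fun j _ => ?_
      by_cases hij : i = j
      · rw [hij]
      · exact mul_le_mul_of_nonpos_left (hmin j (x i)) (hD.offDiag_nonpos i j hij)
    linarith [hμ i (x i)]
  have h4 : ∑ i, Λ i * (μ i + c) ≤ ∑ i, Λ i * ∑ j, D i j * v j (x j) :=
    Finset.sum_le_sum fun i _ => mul_le_mul_of_nonneg_left (h1 i) (hΛ.1 i).le
  rw [sum_mul_sum_eq_zero hΛ] at h4
  simp_rw [mul_add, Finset.sum_add_distrib, ← Finset.sum_mul] at h4
  linarith

end comparison

theorem theorem4p3 {m N : ℕ} (hm : 0 < m)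
    (D : Matrix (Fin m) (Fin m) ℝ)
    (hD : IsCouplingMatrix D)
    (hrow : ∀ i, ∑ j, D i j = 0)
    (hirr : IsIrreducibleCoupling D)
    (F : Fin m → Space N → Space N → ℝ)
    (f : Fin m → Space N → ℝ)
    (hFf : IsEikonalSystem F f) :
    ∃ c₁ : ℝ,
      -- the constant vector `(c₁, …, c₁)` lies in the kernel of `D`, and there is a
      -- Lipschitz solution with this vector as right-hand side
      D *ᵥ (fun _ => c₁) = 0 ∧
      (∃ v : Fin m → Space N → ℝ,
        IsErgodicSolution (fun i x p => F i x p - f i x) D (fun _ => c₁) v ∧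
        ∃ K : NNReal, ∀ i, LipschitzWith K (v i)) ∧
      -- uniqueness of the ergodic constant in the kernel of `D`
      (∀ (c : Fin m → ℝ) (v : Fin m → Space N → ℝ),
        D *ᵥ c = 0 →
        IsErgodicSolution (fun i x p => F i x p - f i x) D c v →
        c = fun _ => c₁) ∧
      -- bounds through a positive left null vector, which exists
      (∃ Λ : Fin m → ℝ, IsPositiveLeftNull D Λ) ∧
      (∀ Λ : Fin m → ℝ, IsPositiveLeftNull D Λ →
        ∃ (μ : Fin m → ℝ) (ν : ℝ),
          (∀ i, IsLeast (Set.range (f i)) (μ i)) ∧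
          IsLeast (Set.range fun x => ∑ i, Λ i * f i x) ν ∧
          ∑ i, Λ i * μ i ≤ -c₁ * ∑ i, Λ i ∧
          -c₁ * ∑ i, Λ i ≤ ν) := by
  obtain ⟨c₁, v, hv, hLip⟩ := exists_ergodicSolution hm hFf hD hrow hirr
  refine ⟨c₁, ?_, ⟨v, hv, hLip⟩, fun c w hc hw => ?_,
    exists_isPositiveLeftNull hm hD hrow hirr, fun Λ hΛ => ?_⟩
  · ext i
    simp [Matrix.mulVec, dotProduct, ← Finset.sum_mul, hrow]
  · obtain ⟨b, rfl⟩ : ∃ b : ℝ, c = fun _ => b :=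
      ⟨c ⟨0, hm⟩, funext fun i => eq_of_mulVec_eq_zero hD hrow hirr hc i _⟩
    have hle := le_of_subsolution_of_supersolution hm hFf hD hrow hv.continuous hv.periodic
      hw.continuous hw.periodic hv.subsolution hw.supersolution
    have hge := le_of_subsolution_of_supersolution hm hFf hD hrow hw.continuous hw.periodic
      hv.continuous hv.periodic hw.subsolution hv.supersolution
    rw [le_antisymm hle hge]
  · choose y hy using fun i => (hFf.periodic_f i).exists_isLeast (hFf.continuous_f i)
    obtain ⟨x, hx⟩ := IsTorusPeriodic.exists_isLeast (g := fun x => ∑ i, Λ i * f i x)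
      (fun k x => by
        have h1 : ∀ i, f i (x + EuclideanSpace.single k 1) = f i x :=
          fun i => hFf.periodic_f i k x
        simp only [h1])
      (continuous_finsetSum _ fun i _ => continuous_const.mul (hFf.continuous_f i))
    exact ⟨fun i => f i (y i), _, hy, hx,
      sum_mul_le_neg_mul_sum hFf hD hΛ hv.continuous hv.periodic hv.supersolution
        fun i z => (hy i).2 ⟨z, rfl⟩,
      neg_mul_sum_le hFf hΛ hv.continuous hv.subsolution x⟩
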